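/- Let $k$ be a complete non-Archimedean valued field (the trivial absolute value is allowed), let $n\ge 0$ and $\mathbf r=(r_1,\dots,r_n)\in(\mathbb R_{>0})^n$. Let $\mathbb D_{\mathbf r}$ be the closed $k$-polydisc of polyradius $\mathbf r$ centred at the origin (in the sense of Berkovich), with coordinate functions $T_1,\dots,T_n$, and let $\mathcal A_{\mathbf r}=\{\sum_I a_IT^I : |a_I|\,\mathbf r^I\to 0\}$ be its algebra of analytic functions, with the spectral norm $\|f\|_\infty=\sup_{x\in\mathbb D_{\mathbf r}}|f(x)|$. For a ring $R$ with a non-Archimedean seminorm $\|\cdot\|$, let $\widetilde R=\bigoplus_{\rho>0}\widetilde R_\rho$ with $\widetilde R_\rho=\{\|a\|\le\rho\}/\{\|a\|<\rho\}$ be its graded reduction, and for $a\in R$ with $\|a\|>0$ let $\widetilde a$ be the class of $a$ in degree $\|a\|$. Apply this to $k$ with its absolute value and to $\mathcal A_{\mathbf r}$ with $\|\cdot\|_\infty$; then $\widetilde{\mathcal A_{\mathbf r}}$ is a $\widetilde k$-algebra. Write $\tau_j=\widetilde{T_j}$, which is homogeneous of degree $r_j$. Let $f_1,\dots,f_n\in\mathcal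 A_{\mathbf r}$ be nonzero and put $s_i=\|f_i\|_\infty>0$, $\mathbf s=(s_1,\dots,s_n)$. Suppose that there are a matrix $A=(a_{ij})$ with $a_{ij}\in\widetilde k_{s_ir_j^{-1}}$ and $\det A\ne 0$ (that is, $A\in\mathrm{GL}(\widetilde k,\mathbf s,\mathbf r)$) and a vector $B=(b_i)$ with $b_i\in\widetilde k_{s_i}$ such that $$\widetilde{f_i}=\sum_{j=1}^n a_{ij}\tau_j+b_i\qquad(1\le i\le n)$$ in $\widetilde{\mathcal A_{\mathbf r}}$. Then $(f_1,\dots,f_n)$ is a coordinate system on $\mathbb D_{\mathbf r}$ (that is, the $f_i$ induce an isomorphism of $\mathbb D_{\mathbf r}$ onto some closed $k$-polydisc centred at the origin); more precisely, there is a unique morphism of $k$-analytic spaces $\varphi:\mathbb D_{\mathbf r}\to\mathbb D_{\mathbf s}$ with $\varphi^*T_i=f_i$ for all $i$, and $\varphi$ is an isomorphism. -/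

import Mathlib

noncomputable section

namespace Polydisc

/-- The multiplicative group of positive real numbers, in which degrees live. -/
abbrev PosReal : Type := {x : ℝ // 0 < x}

/-! ### Graded reduction of a seminormed ring -/

/-- A non-Archimedean (submultiplicative) seminorm on a commutative ring. -/
structure NonarchSeminorm (A : Type*) [CommRing A] extends RingSeminorm A where
  add_le_max' : ∀ a b : A, toFun (a + b) ≤ max (toFun a) (toFun b)
  one_le' : toFun 1 ≤ 1

namespace NonarchSeminorm

variable {A B : Type*} [CommRing A] [CommRing B]

instance : CoeFun (NonarchSeminorm A) (fun _ => A → ℝ) := ⟨fun N => N.toFun⟩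

theorem nonneg (N : NonarchSeminorm A) (a : A) : 0 ≤ N a :=
  apply_nonneg N.toRingSeminorm a

/-- The Rees ring `⨁_ρ {a | N a ≤ ρ}`, inside the group ring of `PosReal` over `A`. -/
def rees (N : NonarchSeminorm A) : Subring (MonoidAlgebra A PosReal) where
  carrier := {p | ∀ ρ : PosReal, N (p.coeff ρ) ≤ (ρ : ℝ)}
  zero_mem' := fun ρ => by
    have h : N (0 : A) = 0 := N.map_zero'
    simpa [h] using ρ.2.le
  add_mem' := fun {p q} hp hq ρ => by
    simpa using (N.add_le_max' (p.coeff ρ) (q.coeff ρ)).trans (max_le (hp ρ) (hq ρ))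
  neg_mem' := fun {p} hp ρ => by
    have h : N (-p.coeff ρ) = N (p.coeff ρ) := N.neg' _
    simpa [h] using hp ρ
  one_mem' := fun ρ => by
    classical
    have h : N (0 : A) = 0 := N.map_zero'
    rw [MonoidAlgebra.one_def, MonoidAlgebra.coeff_single, Finsupp.single_apply]
    split_ifs with h1
    · rw [← h1]; exact N.one_le'
    · rw [h]; exact ρ.2.le
  mul_mem' := fun {p q} hp hq ρ => by
    classical
    have hz : N (0 : A) = 0 := N.map_zero'
    rw [MonoidAlgebra.coeff_mul]
    simp only [Finsupp.sum]
    have key : ∀ (ι : Type) (t : Finset ι) (F : ι → A), (∀ i ∈ t, N (F i) ≤ (ρ : ℝ)) →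
        N (∑ i ∈ t, F i) ≤ (ρ : ℝ) := by
      intro ι t F
      induction t using Finset.induction_on with
      | empty => intro _; simpa [hz] using ρ.2.le
      | insert a t ha ih =>
        intro hF
        rw [Finset.sum_insert ha]
        exact (N.add_le_max' _ _).trans (max_le (hF a (Finset.mem_insert_self a t))
          (ih fun i hi => hF i (Finset.mem_insert_of_mem hi)))
    refine key _ _ _ fun a _ => key _ _ _ fun b _ => ?_
    split_ifs with hab
    · rw [← hab]
      exact (N.mul_le' _ _).trans (mul_le_mul (hp a) (hq b) (N.nonneg _) a.2.le)
    · rw [hz]; exact ρ.2.le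

/-- The ideal `⨁_ρ {a | N a < ρ}` of the Rees ring. -/
def reesIdeal (N : NonarchSeminorm A) : Ideal N.rees where
  carrier := {p | ∀ ρ : PosReal, N ((p : MonoidAlgebra A PosReal).coeff ρ) < (ρ : ℝ)}
  zero_mem' := fun ρ => by
    have h : N (0 : A) = 0 := N.map_zero'
    simpa [h] using ρ.2
  add_mem' := fun {p q} hp hq ρ => by
    simpa using (N.add_le_max' (p.1.coeff ρ) (q.1.coeff ρ)).trans_lt (max_lt (hp ρ) (hq ρ))
  smul_mem' := fun p q hq ρ => by
    classical
    have hz : N (0 : A) = 0 := N.map_zero'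
    rw [smul_eq_mul, Subring.coe_mul, MonoidAlgebra.coeff_mul]
    simp only [Finsupp.sum]
    have key : ∀ (ι : Type) (t : Finset ι) (F : ι → A), (∀ i ∈ t, N (F i) < (ρ : ℝ)) →
        N (∑ i ∈ t, F i) < (ρ : ℝ) := by
      intro ι t F
      induction t using Finset.induction_on with
      | empty => intro _; simpa [hz] using ρ.2
      | insert a t ha ih =>
        intro hF
        rw [Finset.sum_insert ha]
        exact (N.add_le_max' _ _).trans_lt (max_lt (hF a (Finset.mem_insert_self a t))
          (ih fun i hi => hF i (Finset.mem_insert_of_mem hi)))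
    refine key _ _ _ fun a _ => key _ _ _ fun b _ => ?_
    split_ifs with hab
    · rw [← hab]
      exact (N.mul_le' _ _).trans_lt (mul_lt_mul' (p.2 a) (hq b) (N.nonneg _) a.2)
    · rw [hz]; exact ρ.2

/-- The graded reduction `⨁_ρ {a | N a ≤ ρ} / {a | N a < ρ}`, with `ρ` running over the positive
real numbers. -/
def Reduction (N : NonarchSeminorm A) : Type _ := N.rees ⧸ N.reesIdeal

instance (N : NonarchSeminorm A) : CommRing N.Reduction :=
  inferInstanceAs (CommRing (N.rees ⧸ N.reesIdeal))

/-- The quotient map from the Rees ring to the graded reduction. -/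
def toReduction (N : NonarchSeminorm A) : N.rees →+* N.Reduction := Ideal.Quotient.mk N.reesIdeal

/-- The element `a` placed in degree `ρ` of the Rees ring. -/
def reesSingle (N : NonarchSeminorm A) (ρ : PosReal) (a : A) (h : N a ≤ (ρ : ℝ)) : N.rees :=
  ⟨MonoidAlgebra.single ρ a, fun σ => by
    classical
    have hz : N (0 : A) = 0 := N.map_zero'
    rw [MonoidAlgebra.coeff_single, Finsupp.single_apply]
    split_ifs with h1
    · rw [← h1]; exact h
    · rw [hz]; exact σ.2.le⟩

/-- The class of `a` in the degree `ρ` part of the graded reduction, for `N a ≤ ρ`. -/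
def residue (N : NonarchSeminorm A) (ρ : PosReal) (a : A) (h : N a ≤ (ρ : ℝ)) : N.Reduction :=
  N.toReduction (N.reesSingle ρ a h)

/-- The group of homogeneous elements of degree `ρ` of the graded reduction. -/
def homogeneousPart (N : NonarchSeminorm A) (ρ : PosReal) : AddSubgroup N.Reduction where
  carrier := {x | ∃ (a : A) (h : N a ≤ (ρ : ℝ)), x = N.residue ρ a h}
  zero_mem' := by
    have hz : N (0 : A) = 0 := N.map_zero'
    refine ⟨0, by rw [hz]; exact ρ.2.le, ?_⟩
    have : N.reesSingle ρ 0 (by rw [hz]; exact ρ.2.le) = 0 :=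
      Subtype.ext (MonoidAlgebra.single_zero ρ)
    rw [residue, this, map_zero]
  add_mem' := by
    rintro _ _ ⟨a, ha, rfl⟩ ⟨b, hb, rfl⟩
    have hab : N (a + b) ≤ (ρ : ℝ) := (N.add_le_max' a b).trans (max_le ha hb)
    refine ⟨a + b, hab, ?_⟩
    have : N.reesSingle ρ (a + b) hab = N.reesSingle ρ a ha + N.reesSingle ρ b hb :=
      Subtype.ext (MonoidAlgebra.single_add ρ a b)
    rw [residue, residue, residue, this, map_add]
  neg_mem' := by
    rintro _ ⟨a, ha, rfl⟩
    have hna : N (-a) ≤ (ρ : ℝ) := (N.neg' a).le.trans ha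
    refine ⟨-a, hna, ?_⟩
    have : N.reesSingle ρ (-a) hna = - N.reesSingle ρ a ha :=
      Subtype.ext (MonoidAlgebra.single_neg ρ a)
    rw [residue, residue, this, map_neg]

open Classical in
/-- The graded reduction of an element `a`: its class in degree `N a` (and `0` if `N a = 0`). -/
def reduce (N : NonarchSeminorm A) (a : A) : N.Reduction :=
  if h : 0 < N a then N.residue ⟨N a, h⟩ a le_rfl else 0

/-- The ring homomorphism between Rees rings induced by a norm-nonincreasing homomorphism. -/
def reesMap (N : NonarchSeminorm A) (M : NonarchSeminorm B) (φ : A →+* B)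
    (h : ∀ a, M (φ a) ≤ N a) : N.rees →+* M.rees :=
  ((MonoidAlgebra.mapRingHom PosReal φ).comp N.rees.subtype).codRestrict M.rees
    (fun p ρ => by
      simpa using (h _).trans (p.2 ρ))

/-- The graded ring homomorphism between graded reductions induced by a norm-nonincreasing
homomorphism. -/
def reductionMap (N : NonarchSeminorm A) (M : NonarchSeminorm B) (φ : A →+* B)
    (h : ∀ a, M (φ a) ≤ N a) : N.Reduction →+* M.Reduction :=
  Ideal.quotientMap M.reesIdeal (reesMap N M φ h) (fun p hp ρ => by
    change M (((MonoidAlgebra.mapRingHom PosReal φ) p.1).coeff ρ) < (ρ : ℝ)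
    simpa using (h _).trans_lt (hp ρ))

/-- The homogeneous matrices `(a_ij)` with `a_ij` of degree `s_i / r_j` and nonzero determinant. -/
def homogeneousGL (N : NonarchSeminorm A) {n : ℕ} (s r : Fin n → PosReal) :
    Set (Matrix (Fin n) (Fin n) N.Reduction) :=
  {M | (∀ i j, M i j ∈ N.homogeneousPart (s i / r j)) ∧ M.det ≠ 0}

end NonarchSeminorm

/-! ### Closed polydiscs in the sense of Berkovich -/

variable (k : Type*) [NormedField k] [IsUltrametricDist k]

/-- The absolute value of `k`. -/
def absSeminorm : NonarchSeminorm k where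
  toFun := fun a => ‖a‖
  map_zero' := norm_zero
  add_le' := norm_add_le
  neg' := norm_neg
  mul_le' := fun a b => (norm_mul a b).le
  add_le_max' := IsUltrametricDist.norm_add_le_max
  one_le' := norm_one.le

variable {n m : ℕ}

/-- The algebra of analytic functions on the closed polydisc of polyradius `r`: the power series
`∑ a_I T^I` such that `|a_I| r^I` tends to `0`. -/
def Functions (r : Fin n → PosReal) : Subalgebra k (MvPowerSeries (Fin n) k) where
  __ := MvPowerSeries.IsRestricted.subring (R := k) (fun i => (r i : ℝ))
  algebraMap_mem' := fun a => MvPowerSeries.isRestricted_C (fun i => (r i : ℝ)) a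

variable {k}

/-- The Banach norm `max_I |a_I| r^I` on the algebra of analytic functions. -/
def gaussNorm {r : Fin n → PosReal} (f : Functions k r) : ℝ :=
  MvPowerSeries.gaussNorm (fun a : k => ‖a‖) (fun i => (r i : ℝ)) (f : MvPowerSeries (Fin n) k)

variable (k)

/-- The coordinate function `T_i` on the closed polydisc. -/
def coordinate (r : Fin n → PosReal) (i : Fin n) : Functions k r :=
  ⟨MvPowerSeries.X i, MvPowerSeries.isRestricted_monomial (fun i => (r i : ℝ)) _ _⟩

/-- The closed polydisc of polyradius `r` centred at the origin, i.e. the Berkovich spectrum of its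
algebra of analytic functions: its points are the bounded multiplicative seminorms. -/
structure Space (r : Fin n → PosReal) extends MulRingSeminorm (Functions k r) where
  le_gaussNorm' : ∀ f, toFun f ≤ gaussNorm f
  add_le_max' : ∀ f g, toFun (f + g) ≤ max (toFun f) (toFun g)

variable {k}

/-- The absolute value `|f(x)|` of an analytic function `f` at a point `x`. -/
def absAt {r : Fin n → PosReal} (x : Space k r) (f : Functions k r) : ℝ := x.toFun f

/-- The coarsest topology for which all the functions `x ↦ |f(x)|` are continuous. -/
instance (r : Fin n → PosReal) : TopologicalSpace (Space k r) :=
  TopologicalSpace.induced (fun x f => absAt x f) inferInstance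

theorem absAt_nonneg {r : Fin n → PosReal} (x : Space k r) (f : Functions k r) : 0 ≤ absAt x f :=
  apply_nonneg x.toMulRingSeminorm f

theorem bddAbove_absAt {r : Fin n → PosReal} (f : Functions k r) :
    BddAbove (Set.range fun x : Space k r => absAt x f) :=
  ⟨gaussNorm f, by rintro _ ⟨x, rfl⟩; exact x.le_gaussNorm' f⟩

variable (k)

/-- The spectral norm `‖f‖_∞ = sup_x |f(x)|`. -/
def spectralNorm (r : Fin n → PosReal) : NonarchSeminorm (Functions k r) where
  toFun := fun f => ⨆ x : Space k r, absAt x f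
  map_zero' := by
    have : ∀ x : Space k r, absAt x 0 = 0 := fun x => x.map_zero'
    simp [this]
  add_le' := fun f g =>
    Real.iSup_le (fun x => (x.add_le' f g).trans
      (add_le_add (le_ciSup (bddAbove_absAt f) x) (le_ciSup (bddAbove_absAt g) x)))
      (add_nonneg (Real.iSup_nonneg fun x => absAt_nonneg x f)
        (Real.iSup_nonneg fun x => absAt_nonneg x g))
  neg' := fun f => by
    have : ∀ x : Space k r, absAt x (-f) = absAt x f := fun x => x.neg' f
    simp [this]
  mul_le' := fun f g =>
    Real.iSup_le (fun x => (x.map_mul' f g).le.trans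
      (mul_le_mul (le_ciSup (bddAbove_absAt f) x) (le_ciSup (bddAbove_absAt g) x)
        (absAt_nonneg x g) (Real.iSup_nonneg fun x => absAt_nonneg x f)))
      (mul_nonneg (Real.iSup_nonneg fun x => absAt_nonneg x f)
        (Real.iSup_nonneg fun x => absAt_nonneg x g))
  add_le_max' := fun f g =>
    Real.iSup_le (fun x => (x.add_le_max' f g).trans
      (max_le_max (le_ciSup (bddAbove_absAt f) x) (le_ciSup (bddAbove_absAt g) x)))
      (le_max_of_le_left (Real.iSup_nonneg fun x => absAt_nonneg x f))
  one_le' := Real.iSup_le (fun x => x.map_one'.le) zero_le_one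

theorem spectralNorm_algebraMap_le (r : Fin n → PosReal) (a : k) :
    spectralNorm k r (algebraMap k (Functions k r) a) ≤ absSeminorm k a := by
  classical
  refine Real.iSup_le (fun x => (x.le_gaussNorm' _).trans ?_) (norm_nonneg a)
  refine Real.iSup_le (fun t => ?_) (norm_nonneg a)
  change ‖MvPowerSeries.coeff t (MvPowerSeries.C a)‖ * _ ≤ ‖a‖
  rw [MvPowerSeries.coeff_C]
  split_ifs with h
  · simp [h]
  · simp

/-- The structural homomorphism from the graded reduction of `k` to the graded reduction of the
algebra of analytic functions for the spectral norm. -/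
instance (r : Fin n → PosReal) :
    Algebra (absSeminorm k).Reduction (spectralNorm k r).Reduction :=
  (NonarchSeminorm.reductionMap (absSeminorm k) (spectralNorm k r)
    (algebraMap k (Functions k r)) (spectralNorm_algebraMap_le k r)).toAlgebra

/-- A morphism of `k`-analytic spaces between closed polydiscs: a continuous map together with the
bounded `k`-algebra homomorphism that pulls analytic functions back along it. -/
@[ext]
structure Hom (r : Fin n → PosReal) (s : Fin m → PosReal) where
  toFun : Space k r → Space k s
  pullback : Functions k s →ₐ[k] Functions k r
  continuous_toFun : Continuous toFun
  bounded : ∃ C : ℝ, ∀ g, gaussNorm (pullback g) ≤ C * gaussNorm g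
  absAt_toFun : ∀ x g, absAt (toFun x) g = absAt x (pullback g)

variable {k}

namespace Hom

/-- The identity morphism. -/
def id (r : Fin n → PosReal) : Hom k r r where
  toFun := fun x => x
  pullback := AlgHom.id k _
  continuous_toFun := continuous_id
  bounded := ⟨1, fun g => by simp⟩
  absAt_toFun := fun _ _ => rfl

/-- The composition `ψ ∘ φ` of morphisms. -/
def comp {l : ℕ} {r : Fin n → PosReal} {s : Fin m → PosReal} {t : Fin l → PosReal}
    (ψ : Hom k s t) (φ : Hom k r s) : Hom k r t where
  toFun := fun x => ψ.toFun (φ.toFun x)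
  pullback := φ.pullback.comp ψ.pullback
  continuous_toFun := ψ.continuous_toFun.comp φ.continuous_toFun
  bounded := by
    obtain ⟨C, hC⟩ := φ.bounded
    obtain ⟨D, hD⟩ := ψ.bounded
    have hn : ∀ g : Functions k t, 0 ≤ gaussNorm g := fun g =>
      MvPowerSeries.gaussNorm_nonneg _ _ _ (fun a => norm_nonneg a)
    have hn' : ∀ g : Functions k s, 0 ≤ gaussNorm g := fun g =>
      MvPowerSeries.gaussNorm_nonneg _ _ _ (fun a => norm_nonneg a)
    refine ⟨max C 0 * D, fun g => ?_⟩
    calc gaussNorm (φ.pullback (ψ.pullback g))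
        ≤ C * gaussNorm (ψ.pullback g) := hC _
      _ ≤ max C 0 * gaussNorm (ψ.pullback g) :=
          mul_le_mul_of_nonneg_right (le_max_left _ _) (hn' _)
      _ ≤ max C 0 * (D * gaussNorm g) := mul_le_mul_of_nonneg_left (hD g) (le_max_right _ _)
      _ = max C 0 * D * gaussNorm g := by ring
  absAt_toFun := fun x g => by
    rw [ψ.absAt_toFun, φ.absAt_toFun]; rfl

/-- A morphism is an isomorphism if it has a two-sided inverse morphism. -/
def IsIso {r : Fin n → PosReal} {s : Fin m → PosReal} (φ : Hom k r s) : Prop :=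
  ∃ ψ : Hom k s r, ψ.comp φ = Hom.id r ∧ φ.comp ψ = Hom.id s

end Hom

/-- The functions `f_1, …, f_n` induce an isomorphism from the closed polydisc of polyradius `r` to
the closed polydisc of polyradius `s`: there is one and only one morphism that pulls each
coordinate function `T_i` back to `f_i`, and it is an isomorphism. -/
def InducesIso {r : Fin n → PosReal} (f : Fin n → Functions k r) (s : Fin n → PosReal) : Prop :=
  ∃ φ : Hom k r s, (∀ i, φ.pullback (coordinate k s i) = f i) ∧
    (∀ ψ : Hom k r s, (∀ i, ψ.pullback (coordinate k s i) = f i) → ψ = φ) ∧ φ.IsIso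

/-- The functions `f_1, …, f_n` form a coordinate system: they induce an isomorphism onto some
closed polydisc centred at the origin. -/
def IsCoordinateSystem {r : Fin n → PosReal} (f : Fin n → Functions k r) : Prop :=
  ∃ s : Fin n → PosReal, InducesIso f s

end Polydisc

end

/-!
Let `a` and `b` lift `A` and `B`. The hypothesis on the reductions says that `f i` differs from the
affine function `ℓ i = ∑ j, a i j * T_j + b i` by an element of norm `< s i`. Since the determinant
of `A` is nonzero, `‖det a‖` attains its a priori bound `∏ i, s i / ∏ j, r j`, so by Cramer's rule
`‖a⁻¹ i j‖ ≤ r i / s j`: the inverse of the affine map `ℓ` also respects the polyradii, and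
substituting `ℓ` is an isometric isomorphism. Substituting `f` instead changes this isomorphism by
an operator of norm at most some `ε < 1`, hence is isometric as well, and surjective by the
contraction principle.

The spectral norm is the Gauss norm, because the latter is multiplicative and so is itself a point
of the polydisc: the lexicographically largest dominant terms of `f` and `g` contribute the
dominant term of their product, which nothing can cancel.
-/

noncomputable section

namespace Polydisc

open Filter Topology

/-! ### Monomials -/

section PowerProd

variable {ι A : Type*}

/-- The value `∏ i, x i ^ t i` at `x` of the monomial with exponent `t`. -/
def powerProd [CommMonoid A] (x : ι → A) (t : ι →₀ ℕ) : A := t.prod fun i e => x i ^ e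

/-- The weight `r^t` of the monomial `T^t` in the Gauss norm of polyradius `r`. -/
abbrev weight (r : ι → PosReal) (t : ι →₀ ℕ) : ℝ := powerProd (fun i => (r i : ℝ)) t

section CommMonoid

variable [CommMonoid A] (x : ι → A)

theorem powerProd_zero : powerProd x 0 = 1 := Finsupp.prod_zero_index

theorem powerProd_add (t u : ι →₀ ℕ) : powerProd x (t + u) = powerProd x t * powerProd x u :=
  Finsupp.prod_add_index' (fun _ => pow_zero _) fun _ _ _ => pow_add _ _ _

theorem powerProd_single (i : ι) (e : ℕ) : powerProd x (Finsupp.single i e) = x i ^ e :=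
  Finsupp.prod_single_index (pow_zero _)

theorem map_powerProd {B F : Type*} [CommMonoid B] [FunLike F A B] [MonoidHomClass F A B]
    (φ : F) (t : ι →₀ ℕ) : φ (powerProd x t) = powerProd (fun i => φ (x i)) t := by
  simp only [powerProd, map_finsuppProd, map_pow]

end CommMonoid

theorem weight_pos (r : ι → PosReal) (t : ι →₀ ℕ) : 0 < weight r t :=
  Finset.prod_pos fun i _ => pow_pos (r i).2 _

variable [SeminormedCommRing A]

theorem norm_powerProd_le [NormOneClass A] {x : ι → A} {c : ι → ℝ} (hx : ∀ i, ‖x i‖ ≤ c i)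
    (t : ι →₀ ℕ) : ‖powerProd x t‖ ≤ powerProd c t := by
  induction t using Finsupp.induction_linear with
  | zero => simp [powerProd_zero]
  | add t u iht ihu =>
    simp only [powerProd_add]
    exact norm_mul_le_of_le iht ihu
  | single i e =>
    simp only [powerProd_single]
    exact (norm_pow_le _ _).trans (pow_le_pow_left₀ (norm_nonneg _) (hx i) _)

theorem norm_mul_sub_mul_le [IsUltrametricDist A] {a b c d : A} {ρ σ ε : ℝ} (ha : ‖a‖ ≤ ρ)
    (hd : ‖d‖ ≤ σ) (hac : ‖a - c‖ ≤ ε * ρ) (hbd : ‖b - d‖ ≤ ε * σ) :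
    ‖a * b - c * d‖ ≤ ε * (ρ * σ) := by
  have hleft : ‖a * (b - d)‖ ≤ ε * (ρ * σ) :=
    calc ‖a * (b - d)‖ ≤ ρ * (ε * σ) := norm_mul_le_of_le ha hbd
      _ = ε * (ρ * σ) := by ring
  have hright : ‖(a - c) * d‖ ≤ ε * (ρ * σ) :=
    calc ‖(a - c) * d‖ ≤ ε * ρ * σ := norm_mul_le_of_le hac hd
      _ = ε * (ρ * σ) := by ring
  calc ‖a * b - c * d‖ = ‖a * (b - d) + (a - c) * d‖ := by congr 1; ring
    _ ≤ ε * (ρ * σ) := (IsUltrametricDist.norm_add_le_max _ _).trans (max_le hleft hright)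

variable [NormOneClass A] [IsUltrametricDist A]

theorem norm_pow_sub_pow_le {a c : A} {ρ ε : ℝ} (hε : 0 ≤ ε) (ha : ‖a‖ ≤ ρ) (hc : ‖c‖ ≤ ρ)
    (hac : ‖a - c‖ ≤ ε * ρ) (N : ℕ) : ‖a ^ N - c ^ N‖ ≤ ε * ρ ^ N := by
  induction N with
  | zero => simpa using hε
  | succ N ih =>
    rw [pow_succ', pow_succ', pow_succ']
    exact norm_mul_sub_mul_le ha
      ((norm_pow_le _ _).trans (pow_le_pow_left₀ (norm_nonneg _) hc _)) hac ih

theorem norm_powerProd_sub_powerProd_le {x y : ι → A} {c : ι → ℝ} {ε : ℝ} (hε : 0 ≤ ε)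
    (hx : ∀ i, ‖x i‖ ≤ c i) (hy : ∀ i, ‖y i‖ ≤ c i) (hxy : ∀ i, ‖x i - y i‖ ≤ ε * c i)
    (t : ι →₀ ℕ) : ‖powerProd x t - powerProd y t‖ ≤ ε * powerProd c t := by
  induction t using Finsupp.induction_linear with
  | zero => simpa [powerProd_zero] using hε
  | add t u iht ihu =>
    simp only [powerProd_add]
    exact norm_mul_sub_mul_le (norm_powerProd_le hx t) (norm_powerProd_le hy u) iht ihu
  | single i e =>
    simp only [powerProd_single]
    exact norm_pow_sub_pow_le hε (hx i) (hy i) (hxy i) e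

end PowerProd

/-! ### Perturbation of isometries -/

section Perturbation

theorem norm_eq_of_norm_sub_le_mul_norm {E : Type*} [SeminormedAddCommGroup E]
    [IsUltrametricDist E] {u v : E} {ε : ℝ} (hε : ε < 1) (h : ‖u - v‖ ≤ ε * ‖v‖) :
    ‖u‖ = ‖v‖ := by
  by_contra hne
  have hmax : ‖u - v‖ = max ‖u‖ ‖v‖ := by
    rw [sub_eq_add_neg, IsUltrametricDist.norm_add_eq_max_of_norm_ne_norm (by rwa [norm_neg]),
      norm_neg]
  obtain ⟨hu, hv⟩ := max_le_iff.1 (hmax ▸ h)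
  have hv0 : ‖v‖ = 0 := by nlinarith [norm_nonneg v]
  rw [hv0, mul_zero] at hu
  exact hne (hv0 ▸ le_antisymm hu (norm_nonneg u))

/-- A solution of `φ x = y` is a fixed point of the contraction `x ↦ L⁻¹ (y - (φ x - L x))`. -/
theorem surjective_of_norm_sub_le_mul_norm {E F : Type*} [NormedAddCommGroup E] [CompleteSpace E]
    [SeminormedAddCommGroup F] (L : E ≃+ F) (hL : ∀ y, ‖L.symm y‖ ≤ ‖y‖) (φ : E →+ F) {ε : ℝ}
    (hε₀ : 0 ≤ ε) (hε₁ : ε < 1) (h : ∀ x, ‖φ x - L x‖ ≤ ε * ‖x‖) : Function.Surjective φ := by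
  intro y
  have hcontr : ContractingWith ⟨ε, hε₀⟩ fun x => L.symm (y - (φ x - L x)) := by
    refine ⟨hε₁, LipschitzWith.of_dist_le_mul fun x x' => ?_⟩
    have hdiff : y - (φ x - L x) - (y - (φ x' - L x')) = -(φ (x - x') - L (x - x')) := by
      simp only [map_sub]; abel
    rw [dist_eq_norm, dist_eq_norm, ← map_sub, hdiff]
    exact (hL _).trans ((norm_neg _).trans_le (h _))
  have hfix : L.symm (y - (φ hcontr.fixedPoint - L hcontr.fixedPoint)) = hcontr.fixedPoint :=
    hcontr.fixedPoint_isFixedPt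
  rw [AddEquiv.symm_apply_eq] at hfix
  exact ⟨hcontr.fixedPoint, ((sub_eq_iff_eq_add.1 hfix).trans (add_sub_cancel _ _)).symm⟩

theorem exists_lt_one_forall_le_mul {ι : Type*} [Finite ι] {x c : ι → ℝ} (h : ∀ i, x i < c i) :
    ∃ ε : ℝ, 0 ≤ ε ∧ ε < 1 ∧ ∀ i, x i ≤ ε * c i := by
  have hlim (i : ι) : Tendsto (fun ε => ε * c i) (𝓝[<] (1 : ℝ)) (𝓝 (c i)) :=
    ((continuous_mul_const (c i)).tendsto' 1 (c i) (one_mul _)).mono_left nhdsWithin_le_nhds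
  have hle : ∀ᶠ ε in 𝓝[<] (1 : ℝ), ∀ i, x i ≤ ε * c i :=
    eventually_all.2 fun i => (hlim i).eventually_const_le (h i)
  obtain ⟨ε, hε, hε₀, hε₁⟩ := (hle.and (Ioo_mem_nhdsLT one_pos)).exists
  exact ⟨ε, hε₀.le, hε₁, hε⟩

end Perturbation

variable {k : Type*} [NormedField k] [IsUltrametricDist k] {n m : ℕ}

/-! ### The Banach algebra of analytic functions -/

namespace Functions

variable {r : Fin n → PosReal}

/-- The coefficient of an analytic function at the monomial `T^t`, as a linear form. -/
def coeff (t : Fin n →₀ ℕ) : Functions k r →ₗ[k] k :=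
  (MvPowerSeries.coeff t).comp (Functions k r).val.toLinearMap

theorem ext_coeff {f g : Functions k r} (h : ∀ t, coeff t f = coeff t g) : f = g :=
  Subtype.ext (MvPowerSeries.ext h)

theorem coeff_mul (t : Fin n →₀ ℕ) (f g : Functions k r) :
    coeff t (f * g) = ∑ p ∈ Finset.HasAntidiagonal.antidiagonal t, coeff p.1 f * coeff p.2 g := by
  classical
  exact MvPowerSeries.coeff_mul _ _ _

theorem coeff_algebraMap (a : k) (t : Fin n →₀ ℕ) [Decidable (t = 0)] :
    coeff t (algebraMap k (Functions k r) a) = if t = 0 then a else 0 := by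
  classical
  exact (MvPowerSeries.coeff_C t a).trans (by congr)

theorem coeff_coordinate (i : Fin n) (t : Fin n →₀ ℕ) [Decidable (t = Finsupp.single i 1)] :
    coeff t (coordinate k r i) = if t = Finsupp.single i 1 then 1 else 0 := by
  classical
  exact (MvPowerSeries.coeff_X t i).trans (by congr)

theorem coeff_powerProd_coordinate (t u : Fin n →₀ ℕ) [Decidable (u = t)] :
    coeff u (powerProd (coordinate k r) t) = if u = t then 1 else 0 := by
  classical
  have hcoe : ((powerProd (coordinate k r) t : Functions k r) : MvPowerSeries (Fin n) k) =
      MvPowerSeries.monomial t 1 :=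
    (map_powerProd (coordinate k r) (Functions k r).val t).trans
      (MvPowerSeries.monomial_one_eq t).symm
  exact (congrArg (MvPowerSeries.coeff u) hcoe).trans
    ((MvPowerSeries.coeff_monomial u t 1).trans (by congr))

theorem tendsto_coeff (f : Functions k r) :
    Tendsto (fun t => ‖coeff t f‖ * weight r t) cofinite (𝓝 0) := f.2

theorem finite_setOf_le_norm_coeff (f : Functions k r) {c : ℝ} (hc : 0 < c) :
    {t | c ≤ ‖coeff t f‖ * weight r t}.Finite := by
  simpa only [eventually_cofinite, not_lt] using (tendsto_coeff f).eventually_lt_const hc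

theorem hasGaussNorm (f : Functions k r) :
    MvPowerSeries.HasGaussNorm (fun a : k => ‖a‖) (fun i => (r i : ℝ))
      (f : MvPowerSeries (Fin n) k) :=
  (tendsto_coeff f).bddAbove_range_of_cofinite

theorem gaussNorm_add_le_max (f g : Functions k r) :
    gaussNorm (f + g) ≤ max (gaussNorm f) (gaussNorm g) :=
  MvPowerSeries.gaussNorm_add_le_max _ _ _ _ (fun i => (r i).2.le) norm_nonneg
    IsUltrametricDist.isNonarchimedean_norm (hasGaussNorm f) (hasGaussNorm g)

/-- The Gauss norm as a ring norm. -/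
def gaussRingNorm (r : Fin n → PosReal) : RingNorm (Functions k r) where
  toFun := gaussNorm
  map_zero' := MvPowerSeries.gaussNorm_zero _ _ norm_zero
  add_le' f g := (gaussNorm_add_le_max f g).trans <| max_le_add_of_nonneg
    (MvPowerSeries.gaussNorm_nonneg _ _ _ norm_nonneg)
    (MvPowerSeries.gaussNorm_nonneg _ _ _ norm_nonneg)
  neg' _ := MvPowerSeries.gaussNorm_neg _ _ norm_neg _
  mul_le' f g := MvPowerSeries.gaussNorm_mul_le _ _ _ _ (fun i => (r i).2.le) norm_nonneg
    norm_mul_le IsUltrametricDist.isNonarchimedean_norm norm_zero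
    (hasGaussNorm f) (hasGaussNorm g)
  eq_zero_of_map_eq_zero' f hf := Subtype.ext <|
    (MvPowerSeries.gaussNorm_eq_zero_iff _ _ _ norm_zero norm_nonneg (fun _ => norm_eq_zero.1)
      (fun i => (r i).2) (hasGaussNorm f)).1 hf

instance : NormedCommRing (Functions k r) where
  __ := (gaussRingNorm r).toNormedRing
  mul_comm := mul_comm

instance : IsUltrametricDist (Functions k r) :=
  IsUltrametricDist.isUltrametricDist_of_isNonarchimedean_norm gaussNorm_add_le_max

theorem norm_coeff_mul_weight_le (f : Functions k r) (t : Fin n →₀ ℕ) :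
    ‖coeff t f‖ * weight r t ≤ ‖f‖ :=
  MvPowerSeries.le_gaussNorm _ _ _ (hasGaussNorm f) t

theorem norm_le {f : Functions k r} {C : ℝ} (h : ∀ t, ‖coeff t f‖ * weight r t ≤ C) : ‖f‖ ≤ C :=
  ciSup_le h

theorem exists_norm_coeff_mul_weight_eq_norm (f : Functions k r) :
    ∃ t, ‖coeff t f‖ * weight r t = ‖f‖ := by
  rcases eq_or_ne f 0 with rfl | hf
  · exact ⟨0, by simp⟩
  obtain ⟨t₀, ht₀⟩ : ∃ t, coeff t f ≠ 0 := by
    by_contra! h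
    exact hf (ext_coeff fun t => by rw [h, map_zero])
  obtain ⟨t, ht, hmax⟩ := Set.exists_max_image _ (fun t => ‖coeff t f‖ * weight r t)
    (finite_setOf_le_norm_coeff f (mul_pos (norm_pos_iff.2 ht₀) (weight_pos r t₀)))
    ⟨t₀, Set.mem_ofPred.2 le_rfl⟩
  refine ⟨t, le_antisymm (norm_coeff_mul_weight_le f t) (norm_le fun u => ?_)⟩
  by_cases hu : ‖coeff t₀ f‖ * weight r t₀ ≤ ‖coeff u f‖ * weight r u
  · exact hmax u hu
  · exact (not_le.1 hu).le.trans ht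

theorem exists_lex_max_norm_coeff_mul_weight_eq_norm {f : Functions k r} (hf : f ≠ 0) :
    ∃ i : Fin n →₀ ℕ, ‖coeff i f‖ * weight r i = ‖f‖ ∧
      ∀ t, toLex i < toLex t → ‖coeff t f‖ * weight r t < ‖f‖ := by
  obtain ⟨t₀, ht₀⟩ := exists_norm_coeff_mul_weight_eq_norm f
  obtain ⟨i, hi, hmax⟩ := Set.exists_max_image _ toLex
    (finite_setOf_le_norm_coeff f (norm_pos_iff.2 hf)) ⟨t₀, ht₀.ge⟩
  exact ⟨i, le_antisymm (norm_coeff_mul_weight_le f i) hi, fun t ht =>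
    lt_of_not_ge fun h => ht.not_ge (hmax t h)⟩

theorem norm_coeff_mul_coeff_lt {f g : Functions k r} (hf : f ≠ 0) (hg : g ≠ 0)
    {i j : Fin n →₀ ℕ} (hi : ‖coeff i f‖ * weight r i = ‖f‖)
    (hi_max : ∀ t, toLex i < toLex t → ‖coeff t f‖ * weight r t < ‖f‖)
    (hj : ‖coeff j g‖ * weight r j = ‖g‖)
    (hj_max : ∀ t, toLex j < toLex t → ‖coeff t g‖ * weight r t < ‖g‖)
    {t u : Fin n →₀ ℕ} (hadd : t + u = i + j) (hne : (t, u) ≠ (i, j)) :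
    ‖coeff t f * coeff u g‖ < ‖coeff i f‖ * ‖coeff j g‖ := by
  have hweight : weight r t * weight r u = weight r i * weight r j := by
    rw [← powerProd_add, ← powerProd_add, hadd]
  have hlt : ‖coeff t f‖ * weight r t * (‖coeff u g‖ * weight r u) < ‖f‖ * ‖g‖ := by
    rcases lt_trichotomy (toLex i) (toLex t) with h | h | h
    · exact mul_lt_mul_of_lt_of_le_of_nonneg_of_pos (hi_max t h) (norm_coeff_mul_weight_le g u)
        (by positivity [weight_pos r t]) (norm_pos_iff.2 hg)
    · obtain rfl : i = t := toLex.injective h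
      exact absurd (congrArg (Prod.mk i) (add_left_cancel hadd)) hne
    · have hju : toLex j < toLex u := by
        by_contra! hle
        have hlex := add_lt_add_of_lt_of_le h hle
        rw [← toLex_add, ← toLex_add, hadd] at hlex
        exact hlex.false
      exact mul_lt_mul' (norm_coeff_mul_weight_le f t) (hj_max u hju)
        (by positivity [weight_pos r u]) (norm_pos_iff.2 hf)
  refine lt_of_mul_lt_mul_right ?_ (mul_pos (weight_pos r i) (weight_pos r j)).le
  calc ‖coeff t f * coeff u g‖ * (weight r i * weight r j)
      = ‖coeff t f‖ * weight r t * (‖coeff u g‖ * weight r u) := by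
        rw [← hweight, norm_mul]; ring
    _ < ‖f‖ * ‖g‖ := hlt
    _ = ‖coeff i f‖ * ‖coeff j g‖ * (weight r i * weight r j) := by rw [← hi, ← hj]; ring

instance : NormMulClass (Functions k r) where
  norm_mul f g := by
    classical
    rcases eq_or_ne f 0 with rfl | hf
    · simp
    rcases eq_or_ne g 0 with rfl | hg
    · simp
    obtain ⟨i, hi, hi_max⟩ := exists_lex_max_norm_coeff_mul_weight_eq_norm hf
    obtain ⟨j, hj, hj_max⟩ := exists_lex_max_norm_coeff_mul_weight_eq_norm hg
    exact MvPowerSeries.gaussNorm_mul_eq_mul _ _ _ _ (hasGaussNorm f) (hasGaussNorm g)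
      (hasGaussNorm (f * g)) norm_nonneg norm_zero IsUltrametricDist.isNonarchimedean_norm
      norm_mul norm_neg (fun _ => norm_eq_zero.1) (fun i => (r i).2)
      ⟨i, j, hi, hj, fun p hp hne => norm_coeff_mul_coeff_lt hf hg hi hi_max hj hj_max
        (Finset.HasAntidiagonal.mem_antidiagonal.1 hp) hne⟩

instance : NormOneClass (Functions k r) :=
  NormMulClass.toNormOneClass

theorem norm_algebraMap_le (a : k) : ‖algebraMap k (Functions k r) a‖ ≤ ‖a‖ := by
  classical
  refine norm_le fun t => ?_
  rw [coeff_algebraMap]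
  split_ifs with h
  · simp [h, powerProd_zero]
  · simp

instance : NormedAlgebra k (Functions k r) where
  norm_smul_le a f := by
    rw [Algebra.smul_def, norm_mul]
    exact mul_le_mul_of_nonneg_right (norm_algebraMap_le a) (norm_nonneg f)

theorem norm_coordinate (i : Fin n) : ‖coordinate k r i‖ = r i := by
  classical
  have hweight : weight r (Finsupp.single i 1) = r i := by simp [powerProd_single]
  refine le_antisymm (norm_le fun t => ?_) ?_
  · rw [coeff_coordinate]
    split_ifs with h
    · simp [h, powerProd_single]
    · simpa using (r i).2.le
  · simpa [coeff_coordinate, hweight] using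
      norm_coeff_mul_weight_le (coordinate k r i) (Finsupp.single i 1)

theorem norm_coeff_le (t : Fin n →₀ ℕ) (f : Functions k r) :
    ‖coeff t f‖ ≤ (weight r t)⁻¹ * ‖f‖ := by
  rw [inv_mul_eq_div, le_div_iff₀ (weight_pos r t)]
  exact norm_coeff_mul_weight_le f t

theorem uniformContinuous_coeff (t : Fin n →₀ ℕ) :
    UniformContinuous (coeff t : Functions k r → k) :=
  AddMonoidHomClass.uniformContinuous_of_bound (coeff t : Functions k r →ₗ[k] k) _ (norm_coeff_le t)

section Completeness

variable {u : ℕ → Functions k r} {a : (Fin n →₀ ℕ) → k}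

theorem eventually_forall_norm_coeff_sub_le (hu : CauchySeq u)
    (ha : ∀ t, Tendsto (fun N => coeff t (u N)) atTop (𝓝 (a t))) {ε : ℝ} (hε : 0 < ε) :
    ∀ᶠ N in atTop, ∀ t, ‖coeff t (u N) - a t‖ * weight r t ≤ ε := by
  obtain ⟨N, hN⟩ := Metric.cauchySeq_iff.1 hu ε hε
  filter_upwards [eventually_ge_atTop N] with M hM t
  refine le_of_tendsto (((tendsto_const_nhds.sub (ha t)).norm).mul_const (weight r t)) ?_
  filter_upwards [eventually_ge_atTop N] with K hK
  rw [← map_sub]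
  exact (norm_coeff_mul_weight_le _ t).trans (dist_eq_norm (u M) (u K) ▸ (hN M hM K hK).le)

theorem isRestricted_of_tendsto_coeff (hu : CauchySeq u)
    (ha : ∀ t, Tendsto (fun N => coeff t (u N)) atTop (𝓝 (a t))) :
    MvPowerSeries.IsRestricted (fun i => (r i : ℝ)) (a : MvPowerSeries (Fin n) k) := by
  change Tendsto (fun t => ‖a t‖ * weight r t) cofinite (𝓝 0)
  refine (nhds_basis_Ioo_pos (0 : ℝ)).tendsto_right_iff.2 fun ε hε => ?_
  obtain ⟨N, hN⟩ := (eventually_forall_norm_coeff_sub_le hu ha (half_pos hε)).exists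
  filter_upwards [(tendsto_coeff (u N)).eventually_lt_const (half_pos hε)] with t ht
  have hnonneg : 0 ≤ ‖a t‖ * weight r t := mul_nonneg (norm_nonneg _) (weight_pos r t).le
  refine ⟨by linarith, ?_⟩
  calc ‖a t‖ * weight r t ≤ (‖coeff t (u N)‖ + ‖coeff t (u N) - a t‖) * weight r t :=
        mul_le_mul_of_nonneg_right (norm_le_norm_add_norm_sub _ _) (weight_pos r t).le
    _ < 0 + ε := by linarith [hN t]

instance [CompleteSpace k] : CompleteSpace (Functions k r) := by
  refine Metric.complete_of_cauchySeq_tendsto fun u hu => ?_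
  have hlim (t : Fin n →₀ ℕ) : ∃ a, Tendsto (fun N => coeff t (u N)) atTop (𝓝 a) :=
    cauchySeq_tendsto_of_complete ((uniformContinuous_coeff t).comp_cauchySeq hu)
  choose a ha using hlim
  refine ⟨⟨a, isRestricted_of_tendsto_coeff hu ha⟩, Metric.tendsto_nhds.2 fun ε hε => ?_⟩
  filter_upwards [eventually_forall_norm_coeff_sub_le hu ha (half_pos hε)] with N hN
  rw [dist_eq_norm]
  exact (norm_le fun t => hN t).trans_lt (half_lt_self hε)

end Completeness

/-- The Gauss point of the polydisc, at which `|f|` is the Gauss norm of `f`. -/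
def gaussPoint (r : Fin n → PosReal) : Space k r where
  __ := gaussRingNorm r
  map_one' := norm_one (α := Functions k r)
  map_mul' := norm_mul (α := Functions k r)
  le_gaussNorm' _ := le_rfl
  add_le_max' := gaussNorm_add_le_max

theorem spectralNorm_eq_norm (f : Functions k r) : spectralNorm k r f = ‖f‖ :=
  le_antisymm (Real.iSup_le (fun x => x.le_gaussNorm' f) (norm_nonneg f))
    (le_ciSup (bddAbove_absAt f) (gaussPoint r))

/-! ### Evaluation of analytic functions -/

section Evaluation

variable {s : Fin m → PosReal} {A : Type*}

theorem coeff_sum_coeff_smul_powerProd_coordinate (g : Functions k r) (S : Finset (Fin n →₀ ℕ))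
    (u : Fin n →₀ ℕ) [Decidable (u ∈ S)] :
    coeff u (∑ t ∈ S, coeff t g • powerProd (coordinate k r) t) =
      if u ∈ S then coeff u g else 0 := by
  classical
  simp only [map_sum, map_smul, coeff_powerProd_coordinate, smul_eq_mul, mul_ite, mul_one,
    mul_zero, Finset.sum_ite_eq]
  congr

theorem hasSum_coeff_smul_powerProd_coordinate (g : Functions k r) :
    HasSum (fun t => coeff t g • powerProd (coordinate k r) t) g := by
  classical
  refine Metric.tendsto_nhds.2 fun ε hε => ?_
  rw [SummationFilter.unconditional_filter]
  filter_upwards [eventually_ge_atTop (finite_setOf_le_norm_coeff g (half_pos hε)).toFinset]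
    with S hS
  rw [dist_eq_norm]
  refine (norm_le fun u => ?_).trans_lt (half_lt_self hε)
  rw [map_sub, coeff_sum_coeff_smul_powerProd_coordinate]
  split_ifs with hu
  · simpa using (half_pos hε).le
  · have hlt : ¬ε / 2 ≤ ‖coeff u g‖ * weight r u := fun h =>
      hu (hS ((Set.Finite.mem_toFinset _).2 h))
    simpa using (not_le.1 hlt).le

theorem algHom_ext_of_continuous [CommRing A] [Algebra k A] [TopologicalSpace A] [T2Space A]
    {φ ψ : Functions k s →ₐ[k] A} (hφ : Continuous φ) (hψ : Continuous ψ)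
    (h : ∀ i, φ (coordinate k s i) = ψ (coordinate k s i)) : φ = ψ := by
  refine AlgHom.ext fun g => ?_
  have hφg := (hasSum_coeff_smul_powerProd_coordinate g).map φ hφ
  have hψg := (hasSum_coeff_smul_powerProd_coordinate g).map ψ hψ
  have hterm : φ ∘ (fun t => coeff t g • powerProd (coordinate k s) t) =
      ψ ∘ fun t => coeff t g • powerProd (coordinate k s) t := by
    funext t
    simp only [Function.comp_apply, map_smul, map_powerProd, h]
  exact (hterm ▸ hφg).unique hψg

theorem norm_coeff_smul_powerProd_le [SeminormedCommRing A] [NormedAlgebra k A] [NormOneClass A]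
    {x : Fin m → A} (hx : ∀ i, ‖x i‖ ≤ s i) (g : Functions k s) (t : Fin m →₀ ℕ) :
    ‖coeff t g • powerProd x t‖ ≤ ‖coeff t g‖ * weight s t :=
  (norm_smul_le _ _).trans
    (mul_le_mul_of_nonneg_left (norm_powerProd_le hx t) (norm_nonneg _))

theorem tsum_coeff_algebraMap_smul_powerProd [CommRing A] [Algebra k A]
    [TopologicalSpace A] (x : Fin m → A) (a : k) :
    ∑' t, coeff t (algebraMap k (Functions k s) a) • powerProd x t = algebraMap k A a := by
  classical
  rw [tsum_eq_single 0 fun t ht => by rw [coeff_algebraMap, if_neg ht, zero_smul],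
    coeff_algebraMap, if_pos rfl, powerProd_zero, Algebra.algebraMap_eq_smul_one]

theorem tsum_mul_tsum_eq_tsum_sum_antidiagonal {ι : Type*} [NormedCommRing A]
    [IsUltrametricDist A] [AddCommMonoid ι] [Finset.HasAntidiagonal ι] {x y : ι → A}
    (hx : Summable x) (hy : Summable y) : (∑' t, x t) * ∑' t, y t =
      ∑' t, ∑ p ∈ Finset.HasAntidiagonal.antidiagonal t, x p.1 * y p.2 :=
  have : NonarchimedeanRing A := ⟨NonarchimedeanAddGroup.is_nonarchimedean⟩
  hx.tsum_mul_tsum_eq_tsum_sum_antidiagonal hy (hx.mul_of_nonarchimedean hy)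

variable [NormedCommRing A] [NormedAlgebra k A] [NormOneClass A] [IsUltrametricDist A]
  [CompleteSpace A] {x y : Fin m → A}

theorem summable_coeff_smul_powerProd (hx : ∀ i, ‖x i‖ ≤ s i) (g : Functions k s) :
    Summable fun t => coeff t g • powerProd x t :=
  NonarchimedeanAddGroup.summable_of_tendsto_cofinite_zero <|
    squeeze_zero_norm (norm_coeff_smul_powerProd_le hx g) (tendsto_coeff g)

theorem tsum_coeff_mul_smul_powerProd (hx : ∀ i, ‖x i‖ ≤ s i) (g h : Functions k s) :
    ∑' t, coeff t (g * h) • powerProd x t =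
      (∑' t, coeff t g • powerProd x t) * ∑' t, coeff t h • powerProd x t := by
  rw [tsum_mul_tsum_eq_tsum_sum_antidiagonal (summable_coeff_smul_powerProd hx g)
    (summable_coeff_smul_powerProd hx h)]
  refine tsum_congr fun t => ?_
  rw [coeff_mul, Finset.sum_smul]
  refine Finset.sum_congr rfl fun p hp => ?_
  rw [← Finset.HasAntidiagonal.mem_antidiagonal.1 hp, powerProd_add, smul_mul_smul_comm]

/-- Evaluation of the analytic functions on the polydisc of polyradius `s` at elements `x i` of a
non-Archimedean Banach algebra with `‖x i‖ ≤ s i`. -/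
def eval (x : Fin m → A) (hx : ∀ i, ‖x i‖ ≤ s i) : Functions k s →ₐ[k] A where
  toFun g := ∑' t, coeff t g • powerProd x t
  map_one' := by
    simpa only [map_one] using tsum_coeff_algebraMap_smul_powerProd (k := k) (s := s) x 1
  map_zero' := by simp only [map_zero, zero_smul, tsum_zero]
  map_mul' := tsum_coeff_mul_smul_powerProd hx
  map_add' g h := by
    simp only [map_add, add_smul]
    exact (summable_coeff_smul_powerProd hx g).tsum_add (summable_coeff_smul_powerProd hx h)
  commutes' := tsum_coeff_algebraMap_smul_powerProd x

theorem hasSum_eval (hx : ∀ i, ‖x i‖ ≤ s i) (g : Functions k s) :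
    HasSum (fun t => coeff t g • powerProd x t) (eval x hx g) :=
  (summable_coeff_smul_powerProd hx g).hasSum

theorem eval_coordinate (hx : ∀ i, ‖x i‖ ≤ s i) (i : Fin m) :
    eval x hx (coordinate k s i) = x i := by
  classical
  refine (hasSum_eval hx _).unique ?_
  convert hasSum_single (Finsupp.single i 1) fun t ht => ?_ using 1
  · rw [coeff_coordinate, if_pos rfl, one_smul, powerProd_single, pow_one]
  · rw [coeff_coordinate, if_neg ht, zero_smul]

theorem norm_eval_le (hx : ∀ i, ‖x i‖ ≤ s i) (g : Functions k s) : ‖eval x hx g‖ ≤ ‖g‖ :=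
  IsUltrametricDist.norm_tsum_le_of_forall_le_of_nonneg (norm_nonneg g) fun t =>
    (norm_coeff_smul_powerProd_le hx g t).trans (norm_coeff_mul_weight_le g t)

theorem norm_eval_sub_eval_le (hx : ∀ i, ‖x i‖ ≤ s i) (hy : ∀ i, ‖y i‖ ≤ s i) {ε : ℝ}
    (hε : 0 ≤ ε) (hxy : ∀ i, ‖x i - y i‖ ≤ ε * s i) (g : Functions k s) :
    ‖eval x hx g - eval y hy g‖ ≤ ε * ‖g‖ := by
  rw [← ((hasSum_eval hx g).sub (hasSum_eval hy g)).tsum_eq]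
  refine IsUltrametricDist.norm_tsum_le_of_forall_le_of_nonneg
    (mul_nonneg hε (norm_nonneg g)) fun t => ?_
  rw [← smul_sub]
  calc ‖coeff t g • (powerProd x t - powerProd y t)‖
      ≤ ‖coeff t g‖ * (ε * weight s t) := (norm_smul_le _ _).trans <|
        mul_le_mul_of_nonneg_left (norm_powerProd_sub_powerProd_le hε hx hy hxy t) (norm_nonneg _)
    _ = ε * (‖coeff t g‖ * weight s t) := by ring
    _ ≤ ε * ‖g‖ := mul_le_mul_of_nonneg_left (norm_coeff_mul_weight_le g t) hε

theorem continuous_eval (hx : ∀ i, ‖x i‖ ≤ s i) :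
    Continuous (eval x hx : Functions k s →ₐ[k] A) :=
  AddMonoidHomClass.continuous_of_bound _ 1 fun g => by simpa only [one_mul] using norm_eval_le hx g

end Evaluation

section EvalEquiv

variable [CompleteSpace k] {s : Fin m → PosReal} {x : Fin m → Functions k r}
  {y : Fin n → Functions k s} (hx : ∀ i, ‖x i‖ ≤ s i) (hy : ∀ j, ‖y j‖ ≤ r j)

theorem eval_comp_eval_eq_id (hxy : ∀ j, eval x hx (y j) = coordinate k r j) :
    (eval x hx).comp (eval y hy) = AlgHom.id k (Functions k r) :=
  algHom_ext_of_continuous ((continuous_eval hx).comp (continuous_eval hy)) continuous_id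
    fun j => (congrArg (eval x hx) (eval_coordinate hy j)).trans (hxy j)

/-- The isomorphism of algebras of analytic functions given by a change of coordinates `x` with
inverse change of coordinates `y`. -/
def evalEquiv (hxy : ∀ j, eval x hx (y j) = coordinate k r j)
    (hyx : ∀ i, eval y hy (x i) = coordinate k s i) : Functions k s ≃ₐ[k] Functions k r :=
  AlgEquiv.ofAlgHom (eval x hx) (eval y hy) (eval_comp_eval_eq_id hx hy hxy)
    (eval_comp_eval_eq_id hy hx hyx)

theorem norm_evalEquiv (hxy : ∀ j, eval x hx (y j) = coordinate k r j)
    (hyx : ∀ i, eval y hy (x i) = coordinate k s i) (g : Functions k s) :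
    ‖evalEquiv hx hy hxy hyx g‖ = ‖g‖ :=
  (norm_eval_le hx g).antisymm <|
    calc ‖g‖ = ‖eval y hy (evalEquiv hx hy hxy hyx g)‖ :=
          congrArg norm ((evalEquiv hx hy hxy hyx).symm_apply_apply g).symm
      _ ≤ ‖evalEquiv hx hy hxy hyx g‖ := norm_eval_le hy _

end EvalEquiv

end Functions

/-! ### Morphisms of polydiscs -/

theorem Space.ext_absAt {r : Fin n → PosReal} {x y : Space k r}
    (h : ∀ g, absAt x g = absAt y g) : x = y := by
  obtain ⟨x, _, _⟩ := x
  obtain ⟨y, _, _⟩ := y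
  congr
  exact DFunLike.ext _ _ h

namespace Hom

variable {r : Fin n → PosReal} {s : Fin m → PosReal}

/-- The morphism whose pullback is a given norm-nonincreasing algebra homomorphism. -/
def ofAlgHom (φ : Functions k s →ₐ[k] Functions k r) (h : ∀ g, ‖φ g‖ ≤ ‖g‖) : Hom k r s where
  toFun x :=
    { toFun := fun g => absAt x (φ g)
      map_zero' := by rw [map_zero]; exact x.map_zero'
      add_le' := fun f g => by rw [map_add]; exact x.add_le' _ _
      neg' := fun f => by rw [map_neg]; exact x.neg' _
      map_one' := by rw [map_one]; exact x.map_one'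
      map_mul' := fun f g => by rw [map_mul]; exact x.map_mul' _ _
      le_gaussNorm' := fun g => (x.le_gaussNorm' _).trans (h g)
      add_le_max' := fun f g => by rw [map_add]; exact x.add_le_max' _ _ }
  pullback := φ
  continuous_toFun := continuous_induced_rng.2 <| continuous_pi fun g =>
    (continuous_apply (φ g)).comp continuous_induced_dom
  bounded := ⟨1, fun g => (h g).trans_eq (one_mul _).symm⟩
  absAt_toFun _ _ := rfl

theorem ext_pullback {φ ψ : Hom k r s} (h : φ.pullback = ψ.pullback) : φ = ψ :=
  Hom.ext (funext fun x => Space.ext_absAt fun g => by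
    rw [φ.absAt_toFun, ψ.absAt_toFun, h]) h

theorem continuous_pullback (φ : Hom k r s) : Continuous φ.pullback :=
  let ⟨C, hC⟩ := φ.bounded
  AddMonoidHomClass.continuous_of_bound φ.pullback C hC

end Hom

open Functions in
theorem inducesIso_of_norm_eq_of_surjective {r s : Fin n → PosReal}
    (φ : Functions k s →ₐ[k] Functions k r) (hnorm : ∀ g, ‖φ g‖ = ‖g‖)
    (hsurj : Function.Surjective φ) : InducesIso (fun i => φ (coordinate k s i)) s := by
  have hφ : Isometry φ := AddMonoidHomClass.isometry_of_norm φ hnorm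
  let e := AlgEquiv.ofBijective φ ⟨hφ.injective, hsurj⟩
  have he (g : Functions k r) : ‖e.symm g‖ ≤ ‖g‖ :=
    ((hnorm _).symm.trans (congrArg norm (e.apply_symm_apply g))).le
  refine ⟨Hom.ofAlgHom φ fun g => (hnorm g).le, fun _ => rfl, fun ψ hψ => ?_,
    Hom.ofAlgHom e.symm he, ?_, ?_⟩
  · exact Hom.ext_pullback (algHom_ext_of_continuous ψ.continuous_pullback hφ.continuous hψ)
  · exact Hom.ext_pullback (AlgHom.ext e.apply_symm_apply)
  · exact Hom.ext_pullback (AlgHom.ext e.symm_apply_apply)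

/-! ### Graded residues -/

namespace NonarchSeminorm

variable {A B : Type*} [CommRing A] [CommRing B]

theorem coeff_single_lt (N : NonarchSeminorm A) {ρ : PosReal} {a : A} (h : N a < ρ)
    (σ : PosReal) : N ((MonoidAlgebra.single ρ a).coeff σ) < σ := by
  classical
  rw [MonoidAlgebra.coeff_single, Finsupp.single_apply]
  split_ifs with hρσ
  · rwa [← hρσ]
  · exact N.map_zero'.trans_lt σ.2

theorem residue_eq_zero_iff (N : NonarchSeminorm A) {ρ : PosReal} {a : A} (ha : N a ≤ ρ) :
    N.residue ρ a ha = 0 ↔ N a < ρ := by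
  refine Ideal.Quotient.eq_zero_iff_mem.trans ⟨fun h => ?_, N.coeff_single_lt⟩
  have hcoeff : N ((MonoidAlgebra.single ρ a).coeff ρ) < ρ := h ρ
  rwa [MonoidAlgebra.coeff_single, Finsupp.single_eq_same] at hcoeff

theorem residue_add (N : NonarchSeminorm A) {ρ : PosReal} {a b : A} (ha : N a ≤ ρ)
    (hb : N b ≤ ρ) (hab : N (a + b) ≤ ρ) :
    N.residue ρ (a + b) hab = N.residue ρ a ha + N.residue ρ b hb :=
  (congrArg N.toReduction (Subtype.ext (MonoidAlgebra.single_add ρ a b))).trans (map_add _ _ _)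

theorem residue_mul (N : NonarchSeminorm A) {ρ σ τ : PosReal} (hτ : ρ * σ = τ) {a b : A}
    (ha : N a ≤ ρ) (hb : N b ≤ σ) (hab : N (a * b) ≤ τ) :
    N.residue τ (a * b) hab = N.residue ρ a ha * N.residue σ b hb := by
  subst hτ
  exact (congrArg N.toReduction (Subtype.ext (MonoidAlgebra.single_mul_single ..).symm)).trans
    (map_mul _ _ _)

theorem sub_lt_of_residue_eq (N : NonarchSeminorm A) {ρ : PosReal} {a b : A} (ha : N a ≤ ρ)
    (hb : N b ≤ ρ) (h : N.residue ρ a ha = N.residue ρ b hb) : N (a - b) < ρ := by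
  have hsub : N (a - b) ≤ ρ := by
    rw [sub_eq_add_neg]
    exact (N.add_le_max' _ _).trans (max_le ha ((N.neg' b).trans_le hb))
  rw [← residue_eq_zero_iff N hsub, ← add_eq_right (b := N.residue ρ b hb),
    ← residue_add N hsub hb (by rwa [sub_add_cancel])]
  simpa only [sub_add_cancel] using h

theorem sum_le (N : NonarchSeminorm A) {ι : Type*} (t : Finset ι) {F : ι → A} {ρ : ℝ}
    (hρ : 0 ≤ ρ) (hF : ∀ i ∈ t, N (F i) ≤ ρ) : N (∑ i ∈ t, F i) ≤ ρ :=
  Finset.sum_induction F (fun a => N a ≤ ρ) (fun _ _ ha hb => (N.add_le_max' _ _).trans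
    (max_le ha hb)) (N.map_zero'.trans_le hρ) hF

theorem residue_sum (N : NonarchSeminorm A) {ι : Type*} (t : Finset ι) {ρ : PosReal} {F : ι → A}
    (hF : ∀ i, N (F i) ≤ ρ) (h : N (∑ i ∈ t, F i) ≤ ρ) :
    N.residue ρ (∑ i ∈ t, F i) h = ∑ i ∈ t, N.residue ρ (F i) (hF i) := by
  simp only [residue, ← map_sum]
  refine congrArg N.toReduction (Subtype.ext ?_)
  rw [AddSubmonoidClass.coe_finsetSum]
  exact map_sum (MonoidAlgebra.singleAddHom ρ) F t

theorem reduce_eq_residue (N : NonarchSeminorm A) {ρ : PosReal} {a : A} (h : (ρ : ℝ) = N a) :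
    N.reduce a = N.residue ρ a h.ge := by
  have hpos : 0 < N a := h ▸ ρ.2
  obtain rfl : ρ = ⟨N a, hpos⟩ := Subtype.ext h
  exact dif_pos hpos

theorem reductionMap_residue (N : NonarchSeminorm A) (M : NonarchSeminorm B) (φ : A →+* B)
    (h : ∀ a, M (φ a) ≤ N a) {ρ : PosReal} {a : A} (ha : N a ≤ ρ) :
    reductionMap N M φ h (N.residue ρ a ha) = M.residue ρ (φ a) ((h a).trans ha) :=
  (Ideal.quotientMap_mk ..).trans <|
    congrArg M.toReduction (Subtype.ext (MonoidAlgebra.mapRingHom_single ..))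

section Determinant

variable {ι : Type*} [Fintype ι] [DecidableEq ι] (N : NonarchSeminorm A) {s r : ι → PosReal}
  {a : Matrix ι ι A} (ha : ∀ i j, N (a i j) ≤ (s i / r j : PosReal))

/-- The homogeneous matrix over the Rees ring with entries `a i j` in degree `s i / r j`. -/
def reesMatrix : Matrix ι ι N.rees :=
  Matrix.of fun i j => N.reesSingle (s i / r j) (a i j) (ha i j)

/-- In the group algebra, a homogeneous matrix is `diag(s) * a * diag(r)⁻¹`. -/
theorem coe_det_reesMatrix : ((N.reesMatrix ha).det : MonoidAlgebra A PosReal) =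
    MonoidAlgebra.single ((∏ i, s i) / ∏ j, r j) a.det := by
  have hfactor : N.rees.subtype.mapMatrix (N.reesMatrix ha) =
      Matrix.diagonal (fun i => MonoidAlgebra.of A PosReal (s i)) *
        (MonoidAlgebra.singleOneRingHom : A →+* MonoidAlgebra A PosReal).mapMatrix a *
        Matrix.diagonal (fun j => MonoidAlgebra.of A PosReal (r j)⁻¹) := by
    ext1 i j
    rw [Matrix.mul_diagonal, Matrix.diagonal_mul]
    change MonoidAlgebra.single (s i / r j) (a i j) =
      MonoidAlgebra.single (s i) 1 * MonoidAlgebra.single 1 (a i j) *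
        MonoidAlgebra.single (r j)⁻¹ 1
    rw [MonoidAlgebra.single_mul_single, MonoidAlgebra.single_mul_single, mul_one, one_mul,
      mul_one, div_eq_mul_inv]
  calc N.rees.subtype (N.reesMatrix ha).det
      = MonoidAlgebra.of A PosReal (∏ i, s i) * MonoidAlgebra.singleOneRingHom a.det *
          MonoidAlgebra.of A PosReal (∏ j, (r j)⁻¹) := by
        rw [RingHom.map_det, hfactor, Matrix.det_mul, Matrix.det_mul, Matrix.det_diagonal,
          Matrix.det_diagonal, ← RingHom.map_det, map_prod, map_prod]
    _ = MonoidAlgebra.single (∏ i, s i) 1 * MonoidAlgebra.single 1 a.det *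
          MonoidAlgebra.single (∏ j, (r j)⁻¹) 1 := rfl
    _ = MonoidAlgebra.single ((∏ i, s i) / ∏ j, r j) a.det := by
        rw [MonoidAlgebra.single_mul_single, MonoidAlgebra.single_mul_single, mul_one, one_mul,
          mul_one, div_eq_mul_inv, Finset.prod_inv_distrib]

theorem det_le (ha : ∀ i j, N (a i j) ≤ (s i / r j : PosReal)) :
    N a.det ≤ ((∏ i, s i) / ∏ j, r j : PosReal) := by
  have h := (N.reesMatrix ha).det.2 ((∏ i, s i) / ∏ j, r j)
  rwa [coe_det_reesMatrix, MonoidAlgebra.coeff_single, Finsupp.single_eq_same] at h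

theorem det_residue : (Matrix.of fun i j => N.residue (s i / r j) (a i j) (ha i j)).det =
    N.residue ((∏ i, s i) / ∏ j, r j) a.det (N.det_le ha) :=
  (N.toReduction.map_det (N.reesMatrix ha)).symm.trans <|
    congrArg N.toReduction (Subtype.ext (N.coe_det_reesMatrix ha))

end Determinant

end NonarchSeminorm

/-! ### Homogeneous matrices -/

section IsGLLift

variable {ι : Type*} [Fintype ι] [DecidableEq ι] {s r : ι → PosReal}

theorem norm_adjugate_le {a : Matrix ι ι k}
    (ha : ∀ i j, ‖a i j‖ ≤ (s i / r j : PosReal)) (i j : ι) :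
    ‖a.adjugate i j‖ ≤ (r i / s j * ((∏ l, s l) / ∏ l, r l) : PosReal) := by
  have hprod : (r i / s j * ((∏ l, s l) / ∏ l, r l) : PosReal) =
      (∏ l, Function.update s j (r i) l) / ∏ l, r l := by
    rw [Finset.prod_update_of_mem (Finset.mem_univ j),
      Finset.prod_eq_mul_prod_sdiff_singleton_of_mem (Finset.mem_univ j) s, ← mul_div_assoc,
      ← mul_assoc, div_mul_cancel]
  rw [Matrix.adjugate_apply, hprod]
  refine (absSeminorm k).det_le fun p q => ?_
  change ‖_‖ ≤ _
  rcases eq_or_ne p j with rfl | hp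
  · rw [Matrix.updateRow_self, Function.update_self]
    rcases eq_or_ne q i with rfl | hq
    · rw [Pi.single_eq_same, div_self', norm_one]
      exact le_rfl
    · rw [Pi.single_eq_of_ne hq, norm_zero]
      exact (Subtype.prop (r i / r q)).le
  · rw [Matrix.updateRow_ne hp, Function.update_of_ne hp]
    exact ha p q

/-- The matrix `a` over `k` lifts an element of `GL(k̃, s, r)`: its entries have classes in degrees
`s i / r j`, and the resulting homogeneous matrix has nonzero determinant, which means that
`‖det a‖` attains its a priori bound `∏ i, s i / ∏ j, r j`. -/
structure IsGLLift (s r : ι → PosReal) (a : Matrix ι ι k) : Prop where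
  norm_le : ∀ i j, ‖a i j‖ ≤ (s i / r j : PosReal)
  le_norm_det : ((∏ i, s i) / ∏ j, r j : PosReal) ≤ ‖a.det‖

namespace IsGLLift

variable {a : Matrix ι ι k}

theorem norm_det (ha : IsGLLift s r a) : ‖a.det‖ = ((∏ i, s i) / ∏ j, r j : PosReal) :=
  ((absSeminorm k).det_le ha.norm_le).antisymm ha.le_norm_det

theorem isUnit_det (ha : IsGLLift s r a) : IsUnit a.det :=
  isUnit_iff_ne_zero.2 <| norm_pos_iff.1 <| ha.norm_det ▸ Subtype.prop _

theorem norm_inv_le (ha : IsGLLift s r a) (i j : ι) : ‖a⁻¹ i j‖ ≤ (r i / s j : PosReal) := by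
  rw [Matrix.inv_def, Matrix.smul_apply, smul_eq_mul, Ring.inverse_eq_inv', norm_mul, norm_inv,
    inv_mul_le_iff₀ (norm_pos_iff.2 ha.isUnit_det.ne_zero), ha.norm_det, mul_comm,
    ← Positive.val_mul]
  exact norm_adjugate_le ha.norm_le i j

end IsGLLift

theorem exists_isGLLift {s r : Fin n → PosReal}
    {α : Matrix (Fin n) (Fin n) (absSeminorm k).Reduction}
    (hα : α ∈ (absSeminorm k).homogeneousGL s r) :
    ∃ (a : Matrix (Fin n) (Fin n) k) (ha : IsGLLift s r a),
      ∀ i j, α i j = (absSeminorm k).residue (s i / r j) (a i j) (ha.norm_le i j) := by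
  choose a ha hαa using hα.1
  refine ⟨Matrix.of a, ⟨ha, ?_⟩, hαa⟩
  by_contra! hlt
  refine hα.2 ?_
  rw [Matrix.ext hαa]
  exact ((absSeminorm k).det_residue (a := Matrix.of a) ha).trans
    (((absSeminorm k).residue_eq_zero_iff _).2 hlt)

end IsGLLift

/-! ### Affine changes of coordinates -/

section Affine

open Functions NonarchSeminorm

variable {r s : Fin n → PosReal}

theorem norm_smul_le_of_norm_le_div {K A : Type*} [NormedField K] [SeminormedAddCommGroup A]
    [NormedSpace K A] {ρ σ : PosReal} {c : K} {x : A} (hc : ‖c‖ ≤ (σ / ρ : PosReal))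
    (hx : ‖x‖ ≤ ρ) : ‖c • x‖ ≤ σ :=
  calc ‖c • x‖ ≤ ‖c‖ * ‖x‖ := norm_smul_le c x
    _ ≤ (σ / ρ : PosReal) * ρ := mul_le_mul hc hx (norm_nonneg x) (Subtype.prop (σ / ρ)).le
    _ = σ := by rw [← Positive.val_mul, div_mul_cancel]

theorem norm_sum_smul_le {K A : Type*} [NormedField K] [SeminormedAddCommGroup A]
    [IsUltrametricDist A] [NormedSpace K A] {ι : Type*} [Fintype ι] {r : ι → PosReal}
    {σ : PosReal} {c : ι → K} {x : ι → A} (hc : ∀ j, ‖c j‖ ≤ (σ / r j : PosReal))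
    (hx : ∀ j, ‖x j‖ ≤ r j) : ‖∑ j, c j • x j‖ ≤ σ :=
  IsUltrametricDist.norm_sum_le_of_forall_le_of_nonneg σ.2.le fun j _ =>
    norm_smul_le_of_norm_le_div (hc j) (hx j)

/-- The affine function `∑ j, c j * T_j + d` on the polydisc of polyradius `r`. -/
def affineFunction (r : Fin n → PosReal) (c : Fin n → k) (d : k) : Functions k r :=
  ∑ j, c j • coordinate k r j + algebraMap k (Functions k r) d

theorem affineFunction_single_zero (i : Fin n) :
    affineFunction r (Pi.single i (1 : k)) 0 = coordinate k r i := by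
  classical
  simp [affineFunction, Pi.single_apply]

theorem norm_affineFunction_le {σ : PosReal} {c : Fin n → k} {d : k}
    (hc : ∀ j, ‖c j‖ ≤ (σ / r j : PosReal)) (hd : ‖d‖ ≤ σ) : ‖affineFunction r c d‖ ≤ σ :=
  (IsUltrametricDist.norm_add_le_max _ _).trans <| max_le
    (norm_sum_smul_le hc fun j => (norm_coordinate j).le) ((norm_algebraMap_le d).trans hd)

theorem map_affineFunction {A : Type*} [CommRing A] [Algebra k A] (φ : Functions k r →ₐ[k] A)
    (c : Fin n → k) (d : k) :
    φ (affineFunction r c d) = ∑ j, c j • φ (coordinate k r j) + algebraMap k A d := by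
  simp only [affineFunction, map_add, map_sum, map_smul, AlgHom.commutes]

open scoped Matrix in
theorem sum_smul_affineFunction (c : Fin m → k) (a : Matrix (Fin m) (Fin n) k) (b : Fin m → k)
    (d : k) :
    ∑ i, c i • affineFunction r (a i) (b i) + algebraMap k (Functions k r) d =
      affineFunction r (c ᵥ* a) (c ⬝ᵥ b + d) := by
  simp only [affineFunction, Matrix.vecMul, dotProduct, smul_add, Finset.sum_add_distrib,
    Finset.smul_sum, Finset.sum_smul, smul_smul, map_add, map_sum, ← add_assoc]
  rw [Finset.sum_comm]
  simp only [Algebra.algebraMap_eq_smul_one, smul_smul]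

open scoped Matrix in
theorem map_affineFunction_eq_coordinate {a c : Matrix (Fin n) (Fin n) k} {b d : Fin n → k}
    (hca : c * a = 1) (hd : c *ᵥ b + d = 0) {φ : Functions k s →ₐ[k] Functions k r}
    (hφ : ∀ i, φ (coordinate k s i) = affineFunction r (a i) (b i)) (j : Fin n) :
    φ (affineFunction s (c j) (d j)) = coordinate k r j := by
  have hlinear : c j ᵥ* a = Pi.single j 1 := by
    rw [← Matrix.mul_apply_eq_vecMul, hca]
    exact funext fun _ => Matrix.one_eq_pi_single
  rw [map_affineFunction]
  simp only [hφ]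
  rw [sum_smul_affineFunction, hlinear, ← affineFunction_single_zero j]
  exact congrArg _ (congrFun hd j)

open scoped Matrix in
theorem mulVec_neg_inv_mulVec_add {ι R : Type*} [Fintype ι] [DecidableEq ι] [CommRing R]
    {a : Matrix ι ι R} (ha : IsUnit a.det) (b : ι → R) : a *ᵥ (-(a⁻¹ *ᵥ b)) + b = 0 := by
  rw [Matrix.mulVec_neg, Matrix.mulVec_mulVec, a.mul_nonsing_inv ha, Matrix.one_mulVec,
    neg_add_cancel]

open scoped Matrix in
/-- The change of coordinates `T ↦ a T + b`, with inverse `T ↦ a⁻¹ T - a⁻¹ b`. -/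
def affineEquiv [CompleteSpace k] {a : Matrix (Fin n) (Fin n) k} (ha : IsGLLift s r a)
    {b : Fin n → k} (hb : ∀ i, ‖b i‖ ≤ s i) : Functions k s ≃ₐ[k] Functions k r :=
  evalEquiv (x := fun i => affineFunction r (a i) (b i))
    (y := fun j => affineFunction s (a⁻¹ j) (-(a⁻¹ *ᵥ b) j))
    (fun i => norm_affineFunction_le (ha.norm_le i) (hb i))
    (fun j => norm_affineFunction_le (ha.norm_inv_le j) <|
      (norm_neg _).trans_le (norm_sum_smul_le (ha.norm_inv_le j) hb))
    (map_affineFunction_eq_coordinate (a.nonsing_inv_mul ha.isUnit_det) (add_neg_cancel _)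
      (eval_coordinate _))
    (map_affineFunction_eq_coordinate (b := -(a⁻¹ *ᵥ b)) (a.mul_nonsing_inv ha.isUnit_det)
      (mulVec_neg_inv_mulVec_add ha.isUnit_det b) (eval_coordinate _))

theorem algebraMap_residue (r : Fin n → PosReal) {ρ : PosReal} {a : k}
    (ha : absSeminorm k a ≤ ρ) :
    algebraMap (absSeminorm k).Reduction (spectralNorm k r).Reduction
      ((absSeminorm k).residue ρ a ha) =
    (spectralNorm k r).residue ρ (algebraMap k (Functions k r) a)
      ((spectralNorm_algebraMap_le k r a).trans ha) :=
  reductionMap_residue ..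

theorem reduce_coordinate (j : Fin n) : (spectralNorm k r).reduce (coordinate k r j) =
    (spectralNorm k r).residue (r j) (coordinate k r j)
      ((spectralNorm_eq_norm _).trans_le (norm_coordinate j).le) :=
  reduce_eq_residue _ ((spectralNorm_eq_norm _).trans (norm_coordinate j)).symm

theorem residue_affineFunction {σ : PosReal} {c : Fin n → k} {d : k}
    (hc : ∀ j, absSeminorm k (c j) ≤ (σ / r j : PosReal)) (hd : absSeminorm k d ≤ σ) :
    (spectralNorm k r).residue σ (affineFunction r c d)
        ((spectralNorm_eq_norm _).trans_le (norm_affineFunction_le hc hd)) =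
      ∑ j, (absSeminorm k).residue (σ / r j) (c j) (hc j) •
        (spectralNorm k r).reduce (coordinate k r j) +
        algebraMap _ (spectralNorm k r).Reduction ((absSeminorm k).residue σ d hd) := by
  have hterm (j : Fin n) : spectralNorm k r (c j • coordinate k r j) ≤ σ :=
    (spectralNorm_eq_norm _).trans_le
      (norm_smul_le_of_norm_le_div (hc j) (norm_coordinate j).le)
  have hresidue (j : Fin n) : (spectralNorm k r).residue σ (c j • coordinate k r j) (hterm j) =
      (absSeminorm k).residue (σ / r j) (c j) (hc j) •
        (spectralNorm k r).reduce (coordinate k r j) := by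
    have hmul : spectralNorm k r (algebraMap k _ (c j) * coordinate k r j) ≤ σ :=
      Algebra.smul_def (c j) (coordinate k r j) ▸ hterm j
    rw [Algebra.smul_def ((absSeminorm k).residue ..), algebraMap_residue, reduce_coordinate,
      ← residue_mul _ (div_mul_cancel σ (r j)) _ _ hmul]
    simp only [Algebra.smul_def]
  simp only [← hresidue]
  rw [algebraMap_residue, ← residue_sum _ _ hterm (sum_le _ _ σ.2.le fun j _ => hterm j)]
  exact residue_add _ _ _ _

theorem norm_sub_affineFunction_lt {σ : PosReal} {f : Functions k r}
    (hσ : (σ : ℝ) = spectralNorm k r f) {c : Fin n → k} {d : k}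
    (hc : ∀ j, absSeminorm k (c j) ≤ (σ / r j : PosReal)) (hd : absSeminorm k d ≤ σ)
    (hf : (spectralNorm k r).reduce f =
      ∑ j, (absSeminorm k).residue (σ / r j) (c j) (hc j) •
        (spectralNorm k r).reduce (coordinate k r j) +
        algebraMap _ (spectralNorm k r).Reduction ((absSeminorm k).residue σ d hd)) :
    ‖f - affineFunction r c d‖ < σ := by
  rw [← residue_affineFunction hc hd, reduce_eq_residue _ hσ] at hf
  exact (spectralNorm_eq_norm _).symm.trans_lt (sub_lt_of_residue_eq _ _ _ hf)

theorem inducesIso_of_norm_sub_affineFunction_lt [CompleteSpace k] {f : Fin n → Functions k r}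
    {a : Matrix (Fin n) (Fin n) k} (ha : IsGLLift s r a) {b : Fin n → k} (hb : ∀ i, ‖b i‖ ≤ s i)
    (hf : ∀ i, ‖f i - affineFunction r (a i) (b i)‖ < s i) : InducesIso f s := by
  have hℓ (i : Fin n) : ‖affineFunction r (a i) (b i)‖ ≤ s i :=
    norm_affineFunction_le (ha.norm_le i) (hb i)
  have hfs (i : Fin n) : ‖f i‖ ≤ s i := by
    simpa using (IsUltrametricDist.norm_add_le_max (f i - affineFunction r (a i) (b i))
      (affineFunction r (a i) (b i))).trans (max_le (hf i).le (hℓ i))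
  obtain ⟨ε, hε₀, hε₁, hε⟩ := exists_lt_one_forall_le_mul hf
  let L := affineEquiv ha hb
  have hL_norm (g : Functions k s) : ‖L g‖ = ‖g‖ := norm_evalEquiv _ _ _ _ g
  have hL_symm (g : Functions k r) : ‖L.symm g‖ ≤ ‖g‖ := by
    rw [← hL_norm, L.apply_symm_apply]
  have hclose (g : Functions k s) : ‖eval f hfs g - L g‖ ≤ ε * ‖g‖ :=
    norm_eval_sub_eval_le hfs hℓ hε₀ hε g
  have hnorm (g : Functions k s) : ‖eval f hfs g‖ = ‖g‖ :=
    (norm_eq_of_norm_sub_le_mul_norm hε₁ ((hL_norm g).symm ▸ hclose g)).trans (hL_norm g)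
  have hsurj : Function.Surjective (eval f hfs : Functions k s →ₐ[k] Functions k r) :=
    surjective_of_norm_sub_le_mul_norm L.toAddEquiv hL_symm (eval f hfs : _ →ₐ[k] _).toAddMonoidHom
      hε₀ hε₁ hclose
  simpa only [eval_coordinate] using inducesIso_of_norm_eq_of_surjective (eval f hfs) hnorm hsurj

end Affine

end Polydisc

end

theorem mainTheorem6 {k : Type*} [NormedField k] [IsUltrametricDist k] [CompleteSpace k]
    {n : ℕ} (r s : Fin n → Polydisc.PosReal) (f : Fin n → Polydisc.Functions k r)
    (hs : ∀ i, (s i : ℝ) = Polydisc.spectralNorm k r (f i))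
    (A : Matrix (Fin n) (Fin n) (Polydisc.absSeminorm k).Reduction)
    (hA : A ∈ (Polydisc.absSeminorm k).homogeneousGL s r)
    (B : Fin n → (Polydisc.absSeminorm k).Reduction)
    (hB : ∀ i, B i ∈ (Polydisc.absSeminorm k).homogeneousPart (s i))
    (hf : ∀ i, (Polydisc.spectralNorm k r).reduce (f i) =
      ∑ j, A i j • (Polydisc.spectralNorm k r).reduce (Polydisc.coordinate k r j) +
        algebraMap _ (Polydisc.spectralNorm k r).Reduction (B i)) :
    Polydisc.IsCoordinateSystem f ∧ Polydisc.InducesIso f s := by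
  suffices h : Polydisc.InducesIso f s from ⟨⟨s, h⟩, h⟩
  obtain ⟨a, ha, hAa⟩ := Polydisc.exists_isGLLift hA
  choose b hb hBb using hB
  refine Polydisc.inducesIso_of_norm_sub_affineFunction_lt ha hb fun i => ?_
  refine Polydisc.norm_sub_affineFunction_lt (hs i) (ha.norm_le i) (hb i) ?_
  simp only [hf i, hAa, hBb]
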